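/- **Theorem 3.2.** A signed graph $\Gamma=(G,\sigma)$ is a finite simple graph $G$ with a sign function $\sigma:E(G)\to\{+1,-1\}$; its adjacency matrix has $(u,v)$-entry $\sigma(uv)$ if $uv\in E(G)$ and $0$ otherwise. Let $i_+(\Gamma)$ be the number of positive eigenvalues of this matrix (with multiplicity), $p(\Gamma)$ the number of vertices of degree $1$, and $\theta(\Gamma)=|E(G)|-|V(G)|+c(G)$, where $c(G)$ is the number of connected components of $G$. A signed graph is balanced if the product of the edge signs along each of its cycles is $+1$, and unbalanced otherwise. Isomorphisms of signed graphs preserve edge signs, and a signed cycle $C_m^{\sigma}$ is the cycle on $m\ge 3$ vertices with some sign function. Let $\Gamma$ be a signed graph of order $n$ each of whose connected components has at least two vertices. Then $$i_+(\Gamma)=\frac{n-p(\Gamma)}{2}-\theta(\Gamma)$$ if and only if $\Gamma$ is isomorphic to a disjoint union $C_{n_1}^{\sigma}\cup C_{n_2}^{\sigma}\cup\cdots\cup C_{n_t}^{\sigma}$ of signed cycles, where $n_1+n_2+\cdots+n_t=n$ and, for each $i\in\{1,\dots,t\}$, $n_i\equiv 0\pmod 4$ if $C_{n_i}^{\sigma}$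 is balanced and $n_i\equiv 2\pmod 4$ if $C_{n_i}^{\sigma}$ is unbalanced. (For the empty graph, $t=0$.) -/

import Mathlib

/-- A signed graph on the vertex set `V`: a simple graph together with a sign function on its
edges, with values in `ℤˣ = {1, -1}`. -/
structure SignedGraph (V : Type*) where
  /-- The underlying simple graph. -/
  graph : SimpleGraph V
  /-- The sign function. -/
  sign : graph.edgeSet → ℤˣ

namespace SignedGraph

/-- The sign of a walk: the product of the signs of the edges it runs through, counted with
multiplicity. On a cycle, whose edges are distinct, this is the sign of the cycle. -/
def walkSign {V : Type*} (Γ : SignedGraph V) {u v : V} (w : Γ.graph.Walk u v) : ℤˣ :=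
  (w.edges.attach.map fun e => Γ.sign ⟨e.1, w.edges_subset_edgeSet e.2⟩).prod

/-- A signed graph is balanced if all of its cycles are positive. -/
def Balanced {V : Type*} (Γ : SignedGraph V) : Prop :=
  ∀ (v : V) (w : Γ.graph.Walk v v), w.IsCycle → Γ.walkSign w = 1

open scoped Classical in
/-- The adjacency matrix: the sign of `uv` at an edge `uv`, and `0` elsewhere. -/
noncomputable def adjMatrix {V : Type*} (Γ : SignedGraph V) : Matrix V V ℝ :=
  Matrix.of fun u v => if h : Γ.graph.Adj u v then ((Γ.sign ⟨s(u, v), h⟩ : ℤ) : ℝ) else 0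

theorem adjMatrix_isHermitian {V : Type*} (Γ : SignedGraph V) : Γ.adjMatrix.IsHermitian := by
  ext u v
  simp only [Matrix.conjTranspose_apply, adjMatrix, Matrix.of_apply, star_trivial]
  by_cases h : Γ.graph.Adj u v
  · have e : (⟨s(v, u), h.symm⟩ : Γ.graph.edgeSet) = ⟨s(u, v), h⟩ := Subtype.ext Sym2.eq_swap
    rw [dif_pos h, dif_pos h.symm, e]
  · rw [dif_neg h, dif_neg (fun h' => h h'.symm)]

open scoped Classical in
/-- The positive inertia index: the number of positive eigenvalues of the adjacency matrix,
counted with multiplicity. -/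
noncomputable def posInertia {V : Type*} [Fintype V] (Γ : SignedGraph V) : ℕ :=
  (Finset.univ.filter fun i : V => 0 < Γ.adjMatrix_isHermitian.eigenvalues i).card

open scoped Classical in
/-- The number of pendant vertices, that is, of vertices of degree `1`. -/
noncomputable def pendantCount {V : Type*} [Fintype V] (Γ : SignedGraph V) : ℕ :=
  (Finset.univ.filter fun v : V => Γ.graph.degree v = 1).card

/-- The cyclomatic number `|E| - |V| + c`, where `c` is the number of connected components. -/
noncomputable def cyclomaticNumber {V : Type*} (Γ : SignedGraph V) : ℤ :=
  (Nat.card Γ.graph.edgeSet : ℤ) - (Nat.card V : ℤ) + (Nat.card Γ.graph.ConnectedComponent : ℤ)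

/-- Two signed graphs are isomorphic if there is an isomorphism of their underlying graphs that
preserves the sign of every edge. -/
def Isomorphic {V W : Type*} (Γ : SignedGraph V) (Δ : SignedGraph W) : Prop :=
  ∃ φ : Γ.graph ≃g Δ.graph, ∀ e : Γ.graph.edgeSet, Δ.sign (φ.mapEdgeSet e) = Γ.sign e

/-- The disjoint union of a family of simple graphs. -/
def disjointUnionGraph {ι : Type*} {V : ι → Type*} (G : ∀ i, SimpleGraph (V i)) :
    SimpleGraph (Σ i, V i) where
  Adj x y := ∃ (i : ι) (a b : V i), (G i).Adj a b ∧ x = ⟨i, a⟩ ∧ y = ⟨i, b⟩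
  symm := ⟨by
    rintro x y ⟨i, a, b, h, rfl, rfl⟩
    exact ⟨i, b, a, h.symm, rfl, rfl⟩⟩
  loopless := ⟨by
    rintro x ⟨i, a, b, h, hx, hy⟩
    rw [hx] at hy
    cases hy
    exact h.ne rfl⟩

/-- Every edge of a disjoint union comes from an edge of one of the pieces. -/
theorem exists_edge_of_disjointUnionGraph {ι : Type*} {V : ι → Type*}
    (G : ∀ i, SimpleGraph (V i)) (e : (disjointUnionGraph G).edgeSet) :
    ∃ p : Σ i, (G i).edgeSet, Sym2.map (Sigma.mk p.1) p.2.1 = e.1 := by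
  obtain ⟨e, he⟩ := e
  induction e using Sym2.ind with
  | _ x y =>
    obtain ⟨i, a, b, h, hx, hy⟩ := id he
    refine ⟨⟨i, ⟨s(a, b), h⟩⟩, ?_⟩
    simp only [Sym2.map_mk]
    rw [← hx, ← hy]

/-- The disjoint union of a family of signed graphs: each edge keeps the sign that it has in the
piece it comes from. (That piece and that edge are unique, see `disjointUnion_sign`.) -/
noncomputable def disjointUnion {ι : Type*} {V : ι → Type*} (Γ : ∀ i, SignedGraph (V i)) :
    SignedGraph (Σ i, V i) where
  graph := disjointUnionGraph fun i => (Γ i).graph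
  sign e :=
    let p := (exists_edge_of_disjointUnionGraph (fun i => (Γ i).graph) e).choose
    (Γ p.1).sign p.2

theorem disjointUnion_adj {ι : Type*} {V : ι → Type*} (Γ : ∀ i, SignedGraph (V i)) {i : ι}
    {a b : V i} : (disjointUnion Γ).graph.Adj ⟨i, a⟩ ⟨i, b⟩ ↔ (Γ i).graph.Adj a b := by
  constructor
  · rintro ⟨j, c, d, h, h1, h2⟩
    cases h1
    cases h2
    exact h
  · intro h
    exact ⟨i, a, b, h, rfl, rfl⟩

theorem disjointUnion_sign {ι : Type*} {V : ι → Type*} (Γ : ∀ i, SignedGraph (V i)) {i : ι}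
    {a b : V i} (h : (Γ i).graph.Adj a b) :
    (disjointUnion Γ).sign ⟨s(⟨i, a⟩, ⟨i, b⟩), (disjointUnion_adj Γ).2 h⟩ =
      (Γ i).sign ⟨s(a, b), h⟩ := by
  have key : ∀ p : Σ j, (Γ j).graph.edgeSet,
      Sym2.map (Sigma.mk p.1) p.2.1 = s((⟨i, a⟩ : Σ j, V j), ⟨i, b⟩) →
        (Γ p.1).sign p.2 = (Γ i).sign ⟨s(a, b), h⟩ := by
    rintro ⟨j, ⟨e, he⟩⟩ hp
    induction e using Sym2.ind with
    | _ c d =>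
      simp only [Sym2.map_mk] at hp
      rcases Sym2.eq_iff.1 hp with ⟨h1, h2⟩ | ⟨h1, h2⟩
      · cases h1
        cases h2
        rfl
      · cases h1
        cases h2
        exact congrArg (Γ i).sign (Subtype.ext Sym2.eq_swap)
  exact key _ (exists_edge_of_disjointUnionGraph (fun j => (Γ j).graph) _).choose_spec

end SignedGraph

/-!
The excess of a signed graph is twice the difference of the two sides, written as
`2 i₊ + 2 c + ∑ v, degreeWeight (deg v)`. It is additive over components, and on a connected graph
it is nonnegative, and positive if there are at least two vertices and not all of them have degree
two. This is proved by induction. Deleting a non-cut vertex does not increase `i₊`. Deleting a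
pendant vertex together with its neighbour decreases `i₊` by at least one, since the two span a
hyperbolic plane of the quadratic form `xᵀ A x`. If no such deletion makes the excess positive,
then non-cut vertices have degree two and so do their neighbours; hence being a non-cut vertex of
degree two spreads over the whole graph.

So the components of a graph of excess zero are cycles. A cycle of length `m` has excess
`2 i₊ + 2 - m`, so only even cycles qualify. Their spectrum is symmetric about zero, as they are
bipartite, so together with `0 ≤ 2 i₊ + 2 - m` the excess vanishes if and only if `A` is singular.
Changing the signs of the coordinates turns `A x = 0` into the recurrence `z (k + 2) = -z k`, which
has a nonzero solution closing up around the cycle if and only if the product of the edge signs is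
`(-1) ^ (m / 2)`.
-/

section Signature

open QuadraticMap

variable {K M N : Type*} [Field K] [LinearOrder K] [AddCommGroup M] [Module K M]
  [FiniteDimensional K M] [AddCommGroup N] [Module K N]

theorem finrank_le_sigPos_of_posDef_comp {Q : QuadraticForm K M} {f : N →ₗ[K] M}
    (h : (Q.comp f).PosDef) : Module.finrank K N ≤ sigPos Q := by
  have hf : Function.Injective f := (injective_iff_map_eq_zero f).2 fun x hx => by
    by_contra hne
    simpa [hx] using h x hne
  rw [← LinearMap.finrank_range_of_inj hf]
  refine le_sigPos_of_posDef Q ?_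
  rintro ⟨_, x, rfl⟩ hx
  exact h x fun h0 => hx (by simp [h0])

variable [FiniteDimensional K N]

theorem sigPos_comp_le (Q : QuadraticForm K M) (f : N →ₗ[K] M) :
    sigPos (Q.comp f) ≤ sigPos Q := by
  obtain ⟨W, hW, hpos⟩ := exists_finrank_eq_sigPos_and_posDef (Q.comp f)
  rw [← hW]
  exact finrank_le_sigPos_of_posDef_comp (f := f ∘ₗ W.subtype) hpos

variable [IsStrictOrderedRing K]

/- `u` and `w` span a hyperbolic plane. Subtracting a suitable multiple of the isotropic vector `u`
makes `f x` orthogonal to that plane without changing the value of `Q`. -/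
theorem sigPos_comp_add_one_le {Q : QuadraticForm K M} {u w : M} (hu : Q u = 0)
    (huw : polar Q u w ≠ 0) {f : N →ₗ[K] M} (hf : ∀ x, polar Q u (f x) = 0) :
    sigPos (Q.comp f) + 1 ≤ sigPos Q := by
  obtain ⟨W, hW, hpos⟩ := exists_finrank_eq_sigPos_and_posDef (Q.comp f)
  set α := polar Q u w with hα
  let p : M := w + ((1 - Q w) / α) • u
  let s : N →ₗ[K] K := α⁻¹ • (Q.polarBilin w ∘ₗ f)
  let g : N →ₗ[K] M := f - s.smulRight u
  have hs (x : N) : s x * α = polar Q w (f x) := by simp [s, mul_comm, huw]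
  have hp : Q p = 1 := by
    rw [QuadraticMap.map_add Q, QuadraticMap.map_smul, polar_smul_right, polar_comm, ← hα, hu]
    simp [huw]
  have hg (x : N) : Q (g x) = Q (f x) := by
    simp [g, sub_eq_add_neg, QuadraticMap.map_add Q, QuadraticMap.map_neg, QuadraticMap.map_smul,
      polar_comm Q _ u, hu, hf]
  have hpg (x : N) : polar Q p (g x) = 0 := by
    simp [g, p, hf, polar_sub_right, polar_add_left, polar_comm Q w u, ← hα, hs, hu]
  let h : W × K →ₗ[K] M := (g ∘ₗ W.subtype).coprod (LinearMap.toSpanSingleton K M p)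
  have hQ (x : W) (t : K) : Q (h (x, t)) = Q (f x) + t * t := by
    simp [h, QuadraticMap.map_add Q, QuadraticMap.map_smul, polar_comm Q _ p, hg, hpg, hp]
  have key : (Q.comp h).PosDef := by
    rintro ⟨x, t⟩ hxt
    rw [QuadraticMap.comp_apply, hQ]
    by_cases hx : x = 0
    · have ht : t ≠ 0 := fun ht => hxt (by simp [hx, ht])
      simpa [hx] using mul_self_pos.2 ht
    · exact add_pos_of_pos_of_nonneg (hpos x hx) (mul_self_nonneg t)
  simpa [hW] using finrank_le_sigPos_of_posDef_comp key

theorem sigPos_pi {ι : Type*} [Fintype ι] {E : ι → Type*} [∀ i, AddCommGroup (E i)]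
    [∀ i, Module K (E i)] [∀ i, FiniteDimensional K (E i)] (Q : ∀ i, QuadraticForm K (E i)) :
    sigPos (QuadraticMap.pi Q) = ∑ i, sigPos (Q i) := by
  have : Invertible (2 : K) := invertibleOfNonzero two_ne_zero
  choose w hw using fun i => (Q i).equivalent_weightedSumSquares
  have e : (QuadraticMap.pi Q).Equivalent
      (weightedSumSquares K fun k : Σ i, Fin (Module.finrank K (E i)) => w k.1 k.2) :=
    (Equivalent.pi hw).trans ⟨{
      (LinearEquiv.piCurry K fun i (_ : Fin (Module.finrank K (E i))) => K).symm with
      map_app' := fun x => by simp [weightedSumSquares_apply, Fintype.sum_sigma, Sigma.uncurry] }⟩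
  simp_rw [QuadraticForm.sigPos_of_equiv_weightedSumSquares e,
    fun i => QuadraticForm.sigPos_of_equiv_weightedSumSquares (hw i), Set.ncard_eq_toFinset_card',
    Set.toFinset_ofPred, Finset.card_filter, Fintype.sum_sigma]

end Signature

namespace SignedGraph

variable {U V W : Type*}

section AdjacencyMatrix

variable (Γ : SignedGraph V)

theorem adjMatrix_of_adj {u v : V} (h : Γ.graph.Adj u v) :
    Γ.adjMatrix u v = ((Γ.sign ⟨s(u, v), h⟩ : ℤ) : ℝ) := by
  simp [adjMatrix, h]

theorem adjMatrix_of_not_adj {u v : V} (h : ¬ Γ.graph.Adj u v) : Γ.adjMatrix u v = 0 := by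
  simp [adjMatrix, h]

theorem adjMatrix_ne_zero_iff {u v : V} : Γ.adjMatrix u v ≠ 0 ↔ Γ.graph.Adj u v := by
  by_cases h : Γ.graph.Adj u v
  · simp [adjMatrix_of_adj, h]
  · simp [adjMatrix_of_not_adj, h]

theorem adjMatrix_mul_self_of_adj {u v : V} (h : Γ.graph.Adj u v) :
    Γ.adjMatrix u v * Γ.adjMatrix u v = 1 := by
  rw [adjMatrix_of_adj _ h, ← Int.cast_mul, Int.units_coe_mul_self, Int.cast_one]

theorem adjMatrix_isSymm : Γ.adjMatrix.IsSymm :=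
  Matrix.isHermitian_iff_isSymm.1 Γ.adjMatrix_isHermitian

end AdjacencyMatrix

section QuadraticForm

open Matrix QuadraticMap

variable [Fintype V] (Γ : SignedGraph V)

open scoped Classical in
/-- The quadratic form `x ↦ xᵀ A x` on `ℝ^V`, where `A` is the adjacency matrix. -/
noncomputable def adjForm : QuadraticForm ℝ (V → ℝ) :=
  Γ.adjMatrix.toQuadraticForm'

theorem adjForm_apply (x : V → ℝ) : Γ.adjForm x = x ⬝ᵥ Γ.adjMatrix *ᵥ x := by
  simp [adjForm, toQuadraticForm', toLinearMap₂'_apply']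

theorem polar_adjForm (x y : V → ℝ) :
    polar Γ.adjForm x y = 2 * (x ⬝ᵥ Γ.adjMatrix *ᵥ y) := by
  have h : y ⬝ᵥ Γ.adjMatrix *ᵥ x = x ⬝ᵥ Γ.adjMatrix *ᵥ y := by
    rw [dotProduct_mulVec, ← mulVec_transpose, Γ.adjMatrix_isSymm.eq, dotProduct_comm]
  simp only [polar, adjForm_apply, mulVec_add, dotProduct_add, add_dotProduct, h]
  ring

open scoped Classical in
theorem adjForm_equivalent_weightedSumSquares :
    Γ.adjForm.Equivalent (weightedSumSquares ℝ Γ.adjMatrix_isHermitian.eigenvalues) := by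
  set hA := Γ.adjMatrix_isHermitian
  set P : Matrix V V ℝ := hA.eigenvectorUnitary.1
  have hP : P * Pᵀ = 1 := Unitary.coe_mul_star_self hA.eigenvectorUnitary
  have hP' : Pᵀ * P = 1 := Unitary.coe_star_mul_self hA.eigenvectorUnitary
  have hspec : Γ.adjMatrix = P * diagonal hA.eigenvalues * Pᵀ := by
    conv_lhs => rw [hA.spectral_theorem, Unitary.conjStarAlgAut_apply]
    rfl
  refine ⟨{ toLin'OfInv hP hP' with map_app' := fun x => ?_ }⟩
  conv_rhs => rw [adjForm_apply, hspec, ← mulVec_mulVec, ← mulVec_mulVec, dotProduct_mulVec,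
    ← mulVec_transpose]
  simp [weightedSumSquares_apply, dotProduct, mulVec_diagonal, toLin'OfInv, mul_left_comm]

theorem posInertia_eq_sigPos : Γ.posInertia = sigPos Γ.adjForm := by
  classical
  rw [QuadraticForm.sigPos_of_equiv_weightedSumSquares Γ.adjForm_equivalent_weightedSumSquares,
    posInertia, Set.ncard_eq_toFinset_card', Set.toFinset_ofPred]

end QuadraticForm

section Comap

open Matrix QuadraticMap

/-- The pullback of a signed graph along a map into its vertex set; for the inclusion of a set of
vertices this is the induced signed subgraph. -/
def comap (f : W → V) (Γ : SignedGraph V) : SignedGraph W where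
  graph := Γ.graph.comap f
  sign e := Γ.sign ((SimpleGraph.Hom.comap f Γ.graph).mapEdgeSet e)

theorem adjMatrix_comap (f : W → V) (Γ : SignedGraph V) :
    (Γ.comap f).adjMatrix = Γ.adjMatrix.submatrix f f :=
  rfl

theorem comap_comap (f : W → V) (g : U → W) (Γ : SignedGraph V) :
    (Γ.comap f).comap g = Γ.comap (f ∘ g) :=
  congrArg (SignedGraph.mk _) <| funext fun _ =>
    congrArg Γ.sign (Subtype.ext (Sym2.map_map ..))

variable [Fintype V] [Fintype W] (Γ : SignedGraph V) {f : W → V}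

theorem extend_zero_dotProduct (hf : f.Injective) (x : W → ℝ) (y : V → ℝ) :
    Function.extend f x 0 ⬝ᵥ y = x ⬝ᵥ (y ∘ f) :=
  (Fintype.sum_of_injective f hf _ _
    (fun v hv => by rw [Function.extend_apply' _ _ _ hv, Pi.zero_apply, zero_mul])
    (fun w => by rw [hf.extend_apply, Function.comp_apply])).symm

theorem adjForm_comap (hf : f.Injective) :
    (Γ.comap f).adjForm = Γ.adjForm.comp (Function.ExtendByZero.linearMap ℝ f) := by
  ext x
  rw [QuadraticMap.comp_apply, adjForm_apply, adjForm_apply, adjMatrix_comap]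
  change _ = Function.extend f x 0 ⬝ᵥ Γ.adjMatrix *ᵥ Function.extend f x 0
  rw [extend_zero_dotProduct hf]
  congr 1
  ext w
  rw [Function.comp_apply, mulVec, mulVec, dotProduct_comm,
    dotProduct_comm _ (Function.extend f x 0), extend_zero_dotProduct hf]
  rfl

theorem posInertia_comap_le (hf : f.Injective) : (Γ.comap f).posInertia ≤ Γ.posInertia := by
  rw [posInertia_eq_sigPos, posInertia_eq_sigPos, adjForm_comap Γ hf]
  exact sigPos_comp_le _ _

theorem posInertia_comap_add_one_le (hf : f.Injective) {u w : V} (huw : Γ.graph.Adj u w)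
    (hu : ∀ i, ¬ Γ.graph.Adj u (f i)) : (Γ.comap f).posInertia + 1 ≤ Γ.posInertia := by
  classical
  rw [posInertia_eq_sigPos, posInertia_eq_sigPos, adjForm_comap Γ hf]
  have hrow (x : V → ℝ) : Pi.single u 1 ⬝ᵥ Γ.adjMatrix *ᵥ x = Γ.adjMatrix u ⬝ᵥ x := by
    rw [single_one_dotProduct, mulVec]
  refine sigPos_comp_add_one_le (u := Pi.single u 1) (w := Pi.single w 1) ?_ ?_ fun x => ?_
  · rw [adjForm_apply, hrow, dotProduct_single_one, adjMatrix_of_not_adj _ (SimpleGraph.irrefl _)]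
  · rw [polar_adjForm, hrow, dotProduct_single_one]
    exact mul_ne_zero two_ne_zero (Γ.adjMatrix_ne_zero_iff.2 huw)
  · change polar _ _ (Function.extend f x 0) = 0
    rw [polar_adjForm, hrow, dotProduct_comm, extend_zero_dotProduct hf]
    simp [dotProduct, adjMatrix_of_not_adj _ (hu _)]

end Comap

section Isomorphism

variable {Γ : SignedGraph V} {Δ : SignedGraph W}

theorem isomorphic_iff :
    Γ.Isomorphic Δ ↔ ∃ e : V ≃ W, ∀ u v, Δ.adjMatrix (e u) (e v) = Γ.adjMatrix u v := by
  constructor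
  · rintro ⟨φ, hφ⟩
    refine ⟨φ.toEquiv, fun u v => ?_⟩
    by_cases h : Γ.graph.Adj u v
    · have h' : Δ.graph.Adj (φ u) (φ v) := φ.map_adj_iff.2 h
      change Δ.adjMatrix (φ u) (φ v) = _
      rw [adjMatrix_of_adj _ h, adjMatrix_of_adj _ h', ← hφ]
      rfl
    · have h' : ¬ Δ.graph.Adj (φ u) (φ v) := fun h' => h (φ.map_adj_iff.1 h')
      change Δ.adjMatrix (φ u) (φ v) = _
      rw [adjMatrix_of_not_adj _ h, adjMatrix_of_not_adj _ h']
  · rintro ⟨e, he⟩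
    refine ⟨⟨e, fun {u v} => ?_⟩, ?_⟩
    · rw [← adjMatrix_ne_zero_iff, he, adjMatrix_ne_zero_iff]
    · rintro ⟨x, hx⟩
      induction x using Sym2.ind with
      | _ u v =>
        have hx' : Δ.graph.Adj (e u) (e v) := by
          rwa [← adjMatrix_ne_zero_iff, he, adjMatrix_ne_zero_iff]
        have := he u v
        rw [adjMatrix_of_adj _ hx, adjMatrix_of_adj _ hx'] at this
        exact Units.ext (Int.cast_injective this)

theorem Isomorphic.trans {Λ : SignedGraph U} (h : Γ.Isomorphic Δ) (h' : Δ.Isomorphic Λ) :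
    Γ.Isomorphic Λ := by
  rw [isomorphic_iff] at *
  obtain ⟨e, he⟩ := h
  obtain ⟨e', he'⟩ := h'
  exact ⟨e.trans e', fun u v => (he' _ _).trans (he u v)⟩

theorem isomorphic_comap_equiv (Γ : SignedGraph V) (e : W ≃ V) : Γ.Isomorphic (Γ.comap e) :=
  isomorphic_iff.2 ⟨e.symm, fun u v => by simp [adjMatrix_comap]⟩

theorem Isomorphic.posInertia_eq [Fintype V] [Fintype W] (h : Γ.Isomorphic Δ) :
    Γ.posInertia = Δ.posInertia := by
  obtain ⟨e, he⟩ := isomorphic_iff.1 h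
  rw [posInertia_eq_sigPos, posInertia_eq_sigPos]
  refine QuadraticMap.Equivalent.sigPos_eq ⟨{ LinearEquiv.funCongrLeft ℝ ℝ e.symm with
    map_app' := fun x => ?_ }⟩
  rw [adjForm_apply, adjForm_apply]
  simp [dotProduct, Matrix.mulVec, ← e.sum_comp, he, LinearMap.funLeft_apply]

end Isomorphism

end SignedGraph

section Valency

variable {V W : Type*}

/-- The degree of a vertex, defined by `Set.ncard` so that no finiteness instances have to be
transported between a graph and its induced subgraphs. -/
noncomputable def valency (G : SimpleGraph V) (v : V) : ℕ :=
  (G.neighborSet v).ncard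

theorem valency_eq_degree (G : SimpleGraph V) (v : V) [Fintype (G.neighborSet v)] :
    valency G v = G.degree v := by
  rw [valency, Set.ncard_eq_toFinset_card', ← G.card_neighborFinset_eq_degree]
  rfl

theorem valency_iso {G : SimpleGraph V} {H : SimpleGraph W} (φ : G ≃g H) (v : V) :
    valency H (φ v) = valency G v :=
  (Nat.card_congr (φ.mapNeighborSet v)).symm

theorem valency_eq_one_iff {G : SimpleGraph V} {v : V} :
    valency G v = 1 ↔ ∃ w, ∀ x, G.Adj v x ↔ x = w := by
  simp [valency, Set.ncard_eq_one, Set.ext_iff]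

variable {G : SimpleGraph V}

theorem valency_pos_iff [Finite V] {v : V} : 0 < valency G v ↔ ∃ w, G.Adj v w :=
  Set.ncard_pos

open scoped Classical in
theorem valency_eq_valency_induce_add [Finite V] (v : V) (x : ({v}ᶜ : Set V)) :
    valency G x = valency (G.induce {v}ᶜ) x + if G.Adj v x then 1 else 0 := by
  have h : Subtype.val '' (G.induce {v}ᶜ).neighborSet x = G.neighborSet x \ {v} := by
    ext y
    simp [and_comm]
  rw [valency, valency, ← Set.ncard_image_of_injective _ Subtype.val_injective, h]
  split_ifs with hx
  · exact (Set.ncard_sdiff_singleton_add_one (s := G.neighborSet x) hx.symm).symm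
  · rw [Set.sdiff_singleton_eq_self (fun hv => hx hv.symm), add_zero]

/-- The contribution of a vertex of degree `d` to `excess`; it increases by one with `d`, except
for `degreeWeight 1 = degreeWeight 2`. -/
def degreeWeight (d : ℕ) : ℤ := if d ≤ 1 then (d : ℤ) - 2 else d - 3

theorem degreeWeight_succ (d : ℕ) :
    degreeWeight (d + 1) = degreeWeight d + if d = 1 then 0 else 1 := by
  unfold degreeWeight
  split_ifs <;> lia

theorem neg_one_le_degreeWeight {d : ℕ} (h : 0 < d) : -1 ≤ degreeWeight d := by
  unfold degreeWeight
  split_ifs <;> lia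

/-- The sum of the degree weights of all vertices. -/
noncomputable def totalWeight [Fintype V] (G : SimpleGraph V) : ℤ :=
  ∑ v, degreeWeight (valency G v)

theorem totalWeight_eq_totalWeight_induce_add [Fintype V] [DecidableEq V] (v : V) :
    totalWeight G = totalWeight (G.induce {v}ᶜ) + degreeWeight (valency G v) +
      {x ∈ G.neighborSet v | valency G x ≠ 2}.ncard := by
  classical
  have hx (x : ({v}ᶜ : Set V)) : degreeWeight (valency G x) =
      degreeWeight (valency (G.induce {v}ᶜ) x) +
        if G.Adj v x ∧ valency G x ≠ 2 then 1 else 0 := by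
    have := valency_eq_valency_induce_add (G := G) v x
    by_cases h : G.Adj v x
    · rw [if_pos h] at this
      rw [this, degreeWeight_succ]
      simp [h]
    · rw [if_neg h, add_zero] at this
      simp [this, h]
  have hcard : ({x ∈ G.neighborSet v | valency G x ≠ 2}.ncard : ℤ) =
      ∑ x : V, if G.Adj v x ∧ valency G x ≠ 2 then 1 else 0 := by
    rw [Finset.sum_boole, Set.ncard_eq_toFinset_card']
    simp
  have hsplit (f : V → ℤ) : ∑ x, f x = ∑ x : ({v}ᶜ : Set V), f x + f v := by
    rw [Fintype.sum_eq_add_sum_compl v, add_comm]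
    congr 1
    exact Finset.sum_subtype _ (by simp) _
  rw [hcard, totalWeight, hsplit, hsplit (fun x => if G.Adj v x ∧ valency G x ≠ 2 then 1 else 0),
    if_neg fun h => G.irrefl h.1, totalWeight, Fintype.sum_congr _ _ hx, Finset.sum_add_distrib]
  ring

end Valency

section CutVertices

variable {V : Type*} {G : SimpleGraph V} {v x : V}

theorem eq_univ_of_preconnected (hG : G.Preconnected) {S : Set V} (hS : S.Nonempty)
    (h : ∀ ⦃u w⦄, u ∈ S → G.Adj u w → w ∈ S) : S = Set.univ := by
  obtain ⟨u, hu⟩ := hS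
  refine Set.eq_univ_of_forall fun w => ?_
  obtain ⟨p⟩ := hG u w
  induction p with
  | nil => exact hu
  | cons huv _ ih => exact ih (h hu huv)

theorem connected_induce_compl_of_valency_eq_one (hG : G.Connected) (hv : valency G v = 1) :
    (G.induce {v}ᶜ).Connected := by
  have : Fintype (G.neighborSet v) :=
    (Set.finite_of_ncard_ne_zero (s := G.neighborSet v) (hv.trans_ne one_ne_zero)).fintype
  exact hG.induce_compl_singleton_of_degree_eq_one (by rw [← valency_eq_degree, hv])

theorem exists_adj_of_two_le_ncard_supp
    (h : 2 ≤ (G.connectedComponentMk v).supp.ncard) : ∃ w, G.Adj v w := by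
  obtain ⟨x, hx, hne⟩ := Set.exists_ne_of_one_lt_ncard h v
  obtain ⟨w⟩ := (SimpleGraph.ConnectedComponent.exact hx).symm
  cases w with
  | nil => exact (hne rfl).elim
  | cons h _ => exact ⟨_, h⟩

variable [Finite V]

theorem valency_induce_add_one {x : ({v}ᶜ : Set V)} (h : G.Adj v x) :
    valency (G.induce {v}ᶜ) x + 1 = valency G x := by
  classical
  rw [valency_eq_valency_induce_add v x, if_pos h]

/- `x` becomes a pendant vertex of `G - v`, so `G - v - x` is connected; `v` is attached to it by
its second edge. -/
theorem connected_induce_compl_of_adj (hv : (G.induce {v}ᶜ).Connected) (hvx : G.Adj v x)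
    (hv2 : valency G v = 2) (hx2 : valency G x = 2) : (G.induce {x}ᶜ).Connected := by
  set x' : ({v}ᶜ : Set V) := ⟨x, hvx.ne'⟩
  have hx' : valency (G.induce {v}ᶜ) x' = 1 := by
    have : valency (G.induce {v}ᶜ) x' + 1 = valency G x := valency_induce_add_one hvx
    lia
  have hconn := connected_induce_compl_of_valency_eq_one hv hx'
  obtain ⟨y, hvy, hyx⟩ := Set.exists_ne_of_one_lt_ncard (hv2 ▸ one_lt_two : 1 < valency G v) x
  let f : (G.induce {v}ᶜ).induce {x'}ᶜ →g G.induce {x}ᶜ :=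
    { toFun := fun z => ⟨z.1.1, fun h => z.2 (Subtype.ext h)⟩, map_rel' := id }
  have hy (z : ({x}ᶜ : Set V)) : (G.induce {x}ᶜ).Reachable ⟨y, hyx⟩ z := by
    by_cases hz : z.1 = v
    · exact SimpleGraph.Adj.reachable (by simpa [hz] using hvy.symm)
    · exact (hconn.preconnected ⟨⟨y, hvy.ne'⟩, fun h => hyx (congrArg Subtype.val h)⟩
        ⟨⟨z, hz⟩, fun h => z.2 (congrArg Subtype.val h)⟩).map f
  have : Nonempty ({x}ᶜ : Set V) := ⟨⟨y, hyx⟩⟩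
  exact ⟨fun a b => (hy a).symm.trans (hy b)⟩

/- Being a non-cut vertex spreads along edges, by `connected_induce_compl_of_adj`. -/
theorem connected_induce_compl_and_valency_eq_two [Nontrivial V] (hG : G.Connected)
    (h : ∀ v, (G.induce {v}ᶜ).Connected → valency G v = 2 ∧ ∀ x, G.Adj v x → valency G x = 2)
    (v : V) : (G.induce {v}ᶜ).Connected ∧ valency G v = 2 := by
  have huniv : {v | (G.induce {v}ᶜ).Connected} = Set.univ :=
    eq_univ_of_preconnected hG.preconnected
      hG.exists_connected_induce_compl_singleton_of_finite_nontrivial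
      fun a b ha hab => connected_induce_compl_of_adj ha hab (h a ha).1 ((h a ha).2 b hab)
  have hv : (G.induce {v}ᶜ).Connected := huniv.symm.subset (Set.mem_univ v)
  exact ⟨hv, (h v hv).1⟩

theorem connected_induce_compl_of_forall_valency_eq_two (hG : G.Connected)
    (h2 : ∀ v, valency G v = 2) (v : V) : (G.induce {v}ᶜ).Connected := by
  obtain ⟨w, hw⟩ := valency_pos_iff.1 (h2 v ▸ two_pos)
  have : Nontrivial V := ⟨v, w, hw.ne⟩
  exact (connected_induce_compl_and_valency_eq_two hG (fun u _ => ⟨h2 u, fun x _ => h2 x⟩) v).1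

end CutVertices

namespace SignedGraph

section Excess

variable {V W : Type*}

/-- The signed graph obtained by deleting a vertex. -/
def deleteVertex (Γ : SignedGraph V) (v : V) : SignedGraph ({v}ᶜ : Set V) :=
  Γ.comap Subtype.val

theorem deleteVertex_graph {Γ : SignedGraph V} {v : V} :
    (Γ.deleteVertex v).graph = Γ.graph.induce {v}ᶜ :=
  rfl

variable [Fintype V] [Fintype W]

/-- For a signed graph without isolated vertices, twice the difference between `i₊` and
`(n - p) / 2 - θ`, see `posInertia_eq_iff_excess_eq_zero`. -/
noncomputable def excess (Γ : SignedGraph V) : ℤ :=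
  2 * Γ.posInertia + 2 * Nat.card Γ.graph.ConnectedComponent + totalWeight Γ.graph

theorem Isomorphic.excess_eq {Γ : SignedGraph V} {Δ : SignedGraph W} (h : Γ.Isomorphic Δ) :
    Γ.excess = Δ.excess := by
  rw [excess, excess, h.posInertia_eq]
  obtain ⟨φ, -⟩ := h
  rw [Nat.card_congr φ.connectedComponentEquiv, totalWeight, totalWeight,
    ← φ.toEquiv.sum_comp fun w => degreeWeight (valency Δ.graph w)]
  congr 1
  exact Fintype.sum_congr _ _ fun v => congrArg degreeWeight (valency_iso φ v).symm

theorem excess_eq_of_connected {Γ : SignedGraph V} (h : Γ.graph.Connected) :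
    Γ.excess = 2 * Γ.posInertia + 2 + totalWeight Γ.graph := by
  have := h.nonempty
  have := h.preconnected.subsingleton_connectedComponent
  rw [excess, Nat.card_unique, Nat.cast_one, mul_one]

open scoped Classical in
theorem totalWeight_eq_of_forall_degree_pos {G : SimpleGraph V} (h : ∀ v, 0 < G.degree v) :
    totalWeight G = 2 * Nat.card G.edgeSet - 3 * Fintype.card V +
      (Finset.univ.filter fun v => G.degree v = 1).card := by
  have hE : (2 * Nat.card G.edgeSet : ℤ) = ∑ v, (G.degree v : ℤ) := by
    rw [Nat.card_eq_fintype_card, ← SimpleGraph.edgeFinset_card]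
    exact_mod_cast G.sum_degrees_eq_twice_card_edges.symm
  have hV : (3 * Fintype.card V : ℤ) = ∑ v : V, 3 := by simp [mul_comm]
  rw [hE, hV, Finset.card_filter, Nat.cast_sum, ← Finset.sum_sub_distrib, ← Finset.sum_add_distrib]
  refine Fintype.sum_congr _ _ fun v => ?_
  have := h v
  rw [valency_eq_degree, degreeWeight]
  split_ifs <;> lia

theorem posInertia_eq_iff_excess_eq_zero (Γ : SignedGraph V)
    (hΓ : ∀ c : Γ.graph.ConnectedComponent, 2 ≤ c.supp.ncard) :
    (Γ.posInertia : ℝ) =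
        ((Fintype.card V : ℝ) - (Γ.pendantCount : ℝ)) / 2 - (Γ.cyclomaticNumber : ℝ) ↔
      Γ.excess = 0 := by
  classical
  have hdeg (v : V) : 0 < Γ.graph.degree v :=
    (Γ.graph.degree_pos_iff_exists_adj v).2 (exists_adj_of_two_le_ncard_supp (hΓ _))
  have hexcess : Γ.excess = 2 * Γ.posInertia + 2 * Γ.cyclomaticNumber -
      (Fintype.card V - Γ.pendantCount) := by
    rw [excess, totalWeight_eq_of_forall_degree_pos hdeg, cyclomaticNumber, pendantCount,
      Nat.card_eq_fintype_card (α := V)]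
    ring
  rw [← @Int.cast_inj ℝ, hexcess]
  push_cast
  constructor <;> intro h <;> linarith

section Deletion

variable [DecidableEq V] {Γ : SignedGraph V} {u v : V}

theorem excess_deleteVertex_add_le (hΓ : Γ.graph.Connected)
    (hv : (Γ.deleteVertex v).graph.Connected) :
    (Γ.deleteVertex v).excess + degreeWeight (valency Γ.graph v) +
      {x ∈ Γ.graph.neighborSet v | valency Γ.graph x ≠ 2}.ncard ≤ Γ.excess := by
  have hpos : (Γ.deleteVertex v).posInertia ≤ Γ.posInertia :=
    Γ.posInertia_comap_le Subtype.val_injective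
  rw [excess_eq_of_connected hΓ, excess_eq_of_connected hv, deleteVertex_graph,
    totalWeight_eq_totalWeight_induce_add v]
  lia

theorem excess_deletePendant_add_le (hΓ : Γ.graph.Connected) {w : ({u}ᶜ : Set V)}
    (huw : Γ.graph.Adj u w) (hu : valency Γ.graph u = 1)
    (hw : ((Γ.deleteVertex u).deleteVertex w).graph.Connected) :
    ((Γ.deleteVertex u).deleteVertex w).excess + 1 + degreeWeight (valency Γ.graph w) +
      {x ∈ (Γ.deleteVertex u).graph.neighborSet w | valency (Γ.deleteVertex u).graph x ≠ 2}.ncard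
      ≤ Γ.excess := by
  have hN : ∀ x, Γ.graph.Adj u x → x = w := by
    obtain ⟨w', hw'⟩ := valency_eq_one_iff.1 hu
    exact fun x hx => ((hw' x).1 hx).trans ((hw' w).1 huw).symm
  have hpos : ((Γ.deleteVertex u).deleteVertex w).posInertia + 1 ≤ Γ.posInertia := by
    rw [deleteVertex, deleteVertex, comap_comap]
    exact Γ.posInertia_comap_add_one_le (Subtype.val_injective.comp Subtype.val_injective) huw
      fun i hi => i.2 (Subtype.ext (hN _ hi))
  have hdeg : degreeWeight (valency Γ.graph w) ≤
      degreeWeight (valency (Γ.deleteVertex u).graph w) +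
        {x ∈ Γ.graph.neighborSet u | valency Γ.graph x ≠ 2}.ncard := by
    rw [deleteVertex_graph, ← valency_induce_add_one huw, degreeWeight_succ]
    split_ifs with h
    · lia
    · have : 0 < {x ∈ Γ.graph.neighborSet u | valency Γ.graph x ≠ 2}.ncard := by
        rw [Set.ncard_pos]
        exact ⟨w, huw, by rw [← valency_induce_add_one huw]; lia⟩
      lia
  have hu' : degreeWeight (valency Γ.graph u) = -1 := by rw [hu]; rfl
  have h1 := totalWeight_eq_totalWeight_induce_add (G := Γ.graph) u
  have h2 := totalWeight_eq_totalWeight_induce_add (G := (Γ.deleteVertex u).graph) w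
  rw [excess_eq_of_connected hΓ, excess_eq_of_connected hw]
  rw [← deleteVertex_graph] at h1 h2
  lia

end Deletion
end Excess

section ExcessBound
variable {V : Type*} [Fintype V] {Γ : SignedGraph V}

theorem posInertia_pos_of_adj {u w : V} (h : Γ.graph.Adj u w) : 0 < Γ.posInertia :=
  Nat.lt_of_lt_of_le (Nat.succ_pos _)
    (Γ.posInertia_comap_add_one_le (f := Empty.elim) (fun i => i.elim) h fun i => i.elim)

theorem excess_pos_of_card_eq_two (hΓ : Γ.graph.Connected) (hV : Fintype.card V = 2) :
    0 < Γ.excess := by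
  have : Nontrivial V := Fintype.one_lt_card_iff_nontrivial.1 (by lia)
  have hdeg (v : V) : 0 < valency Γ.graph v :=
    valency_pos_iff.2 (hΓ.preconnected.exists_adj_of_nontrivial v)
  have hweight : -2 ≤ totalWeight Γ.graph :=
    calc (-2 : ℤ) = ∑ _ : V, -1 := by simp [hV]
      _ ≤ _ := Finset.sum_le_sum fun v _ => neg_one_le_degreeWeight (hdeg v)
  obtain ⟨w, hw⟩ := valency_pos_iff.1 (hdeg (Classical.arbitrary V))
  have := posInertia_pos_of_adj hw
  rw [excess_eq_of_connected hΓ]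
  lia

/-- The bound on the excess of a connected signed graph that is proved by induction on the number
of vertices. -/
def ExcessBound (Γ : SignedGraph V) : Prop :=
  0 ≤ Γ.excess ∧ (Nontrivial V → (∃ v, valency Γ.graph v ≠ 2) → 0 < Γ.excess)

theorem excessBound_of_subsingleton [Subsingleton V] (hΓ : Γ.graph.Connected) :
    Γ.ExcessBound := by
  have := hΓ.nonempty
  refine ⟨?_, fun hV => (not_nontrivial V hV).elim⟩
  have hdeg (v : V) : valency Γ.graph v = 0 := by
    by_contra h
    obtain ⟨w, hw⟩ := valency_pos_iff.1 (Nat.pos_of_ne_zero h)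
    exact hw.ne (Subsingleton.elim v w)
  have hweight : totalWeight Γ.graph = -2 := by
    rw [totalWeight, Fintype.sum_subsingleton _ (Classical.arbitrary V), hdeg]
    rfl
  rw [excess_eq_of_connected hΓ, hweight]
  lia

section Deletion

variable [DecidableEq V]

theorem excess_pos_of_forall_valency_deleteVertex_eq_two (hΓ : Γ.graph.Connected) {v w : V}
    (hvw : Γ.graph.Adj v w) (hv : (Γ.deleteVertex v).graph.Connected)
    (hreg : ∀ x, valency (Γ.deleteVertex v).graph x = 2) (ih : 0 ≤ (Γ.deleteVertex v).excess)
    (ih' : ∀ w, ((Γ.deleteVertex v).deleteVertex w).graph.Connected →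
      0 ≤ ((Γ.deleteVertex v).deleteVertex w).excess) : 0 < Γ.excess := by
  have h3 (x : V) (hx : Γ.graph.Adj v x) : valency Γ.graph x = 3 := by
    rw [← valency_induce_add_one (x := ⟨x, hx.ne'⟩) hx, ← deleteVertex_graph, hreg]
  obtain hd | hd := eq_or_ne (valency Γ.graph v) 1
  · have hconn := connected_induce_compl_of_forall_valency_eq_two hv hreg ⟨w, hvw.ne'⟩
    have hle := excess_deletePendant_add_le (w := ⟨w, hvw.ne'⟩) hΓ hvw hd hconn
    have hw : degreeWeight (valency Γ.graph w) = 0 := by rw [h3 w hvw]; rfl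
    have := ih' _ hconn
    lia
  · have hall : {x ∈ Γ.graph.neighborSet v | valency Γ.graph x ≠ 2} = Γ.graph.neighborSet v :=
      Set.sep_eq_self_iff_mem_true.2 fun x hx => by simp only [h3 x hx]; decide
    have hle := excess_deleteVertex_add_le hΓ hv
    rw [hall, ← valency] at hle
    have hpos : 0 < degreeWeight (valency Γ.graph v) + valency Γ.graph v := by
      have := valency_pos_iff.2 ⟨w, hvw⟩
      unfold degreeWeight
      split_ifs <;> lia
    lia

theorem excess_pos_of_connected_deleteVertex (hΓ : Γ.graph.Connected) {v w : V}
    (hvw : Γ.graph.Adj v w) (hv : (Γ.deleteVertex v).graph.Connected)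
    (h : 3 ≤ valency Γ.graph v ∨ ∃ x, Γ.graph.Adj v x ∧ valency Γ.graph x ≠ 2)
    (ih : (Γ.deleteVertex v).ExcessBound)
    (ih' : ∀ w, ((Γ.deleteVertex v).deleteVertex w).graph.Connected →
      0 ≤ ((Γ.deleteVertex v).deleteVertex w).excess) : 0 < Γ.excess := by
  by_cases hreg : ∀ x, valency (Γ.deleteVertex v).graph x = 2
  · exact excess_pos_of_forall_valency_deleteVertex_eq_two hΓ hvw hv hreg ih.1 ih'
  push Not at hreg
  obtain hs | hn := subsingleton_or_nontrivial ({v}ᶜ : Set V)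
  · refine excess_pos_of_card_eq_two hΓ ?_
    have hle := Fintype.card_le_one_iff_subsingleton.2 hs
    have hlt : 1 < Fintype.card V := Fintype.one_lt_card_iff.2 ⟨v, w, hvw.ne⟩
    rw [Fintype.card_compl_set, Set.card_singleton] at hle
    lia
  have hgain : 0 ≤ degreeWeight (valency Γ.graph v) +
      {x ∈ Γ.graph.neighborSet v | valency Γ.graph x ≠ 2}.ncard := by
    obtain h | ⟨x, hx⟩ := h
    · unfold degreeWeight
      split_ifs <;> lia
    · have := neg_one_le_degreeWeight (valency_pos_iff.2 ⟨w, hvw⟩)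
      have : 0 < {x ∈ Γ.graph.neighborSet v | valency Γ.graph x ≠ 2}.ncard := by
        rw [Set.ncard_pos]
        exact ⟨x, hx⟩
      lia
  have hle := excess_deleteVertex_add_le hΓ hv
  have := ih.2 hn hreg
  lia

theorem excess_pos_of_valency_eq_one (hΓ : Γ.graph.Connected) {u w : V} (huw : Γ.graph.Adj u w)
    (hu : valency Γ.graph u = 1) (hw : valency Γ.graph w = 2)
    (ih : ((Γ.deleteVertex u).deleteVertex ⟨w, huw.ne'⟩).graph.Connected →
      ((Γ.deleteVertex u).deleteVertex ⟨w, huw.ne'⟩).ExcessBound) : 0 < Γ.excess := by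
  set w' : ({u}ᶜ : Set V) := ⟨w, huw.ne'⟩
  have hw1 : valency (Γ.deleteVertex u).graph w' = 1 := by
    have : valency (Γ.graph.induce {u}ᶜ) w' + 1 = valency Γ.graph w := valency_induce_add_one huw
    rw [deleteVertex_graph]
    lia
  have hconn : ((Γ.deleteVertex u).deleteVertex w').graph.Connected :=
    connected_induce_compl_of_valency_eq_one (connected_induce_compl_of_valency_eq_one hΓ hu) hw1
  have hle := excess_deletePendant_add_le (w := w') hΓ huw hu hconn
  rw [show valency Γ.graph w' = 2 from hw, show degreeWeight 2 = -1 from rfl] at hle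
  obtain ⟨x, hx⟩ := valency_pos_iff.1 (hw1 ▸ one_pos)
  by_cases hx2 : valency (Γ.deleteVertex u).graph x = 2
  · have : valency ((Γ.deleteVertex u).deleteVertex w').graph ⟨x, hx.ne'⟩ + 1 = 2 :=
      (valency_induce_add_one (x := ⟨x, hx.ne'⟩) hx).trans hx2
    obtain ⟨y, hy⟩ := valency_pos_iff.1
      (by lia : 0 < valency ((Γ.deleteVertex u).deleteVertex w').graph ⟨x, hx.ne'⟩)
    have := (ih hconn).2 ⟨_, y, hy.ne⟩ ⟨⟨x, hx.ne'⟩, by lia⟩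
    lia
  · have : 0 < {x ∈ (Γ.deleteVertex u).graph.neighborSet w' |
        valency (Γ.deleteVertex u).graph x ≠ 2}.ncard := by
      rw [Set.ncard_pos]
      exact ⟨x, hx, hx2⟩
    have := (ih hconn).1
    lia

theorem excess_nonneg_of_forall_valency_eq_two (hΓ : Γ.graph.Connected)
    (h2 : ∀ v, valency Γ.graph v = 2) (v : V) (ih : (Γ.deleteVertex v).ExcessBound) :
    0 ≤ Γ.excess := by
  have hconn := connected_induce_compl_of_forall_valency_eq_two hΓ h2 v
  have hle := excess_deleteVertex_add_le hΓ hconn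
  obtain ⟨w, hvw⟩ := valency_pos_iff.1 (h2 v ▸ two_pos)
  have : valency (Γ.deleteVertex v).graph ⟨w, hvw.ne'⟩ + 1 = 2 :=
    (valency_induce_add_one (x := ⟨w, hvw.ne'⟩) hvw).trans (h2 w)
  obtain ⟨y, hy⟩ := valency_pos_iff.1
    (by lia : 0 < valency (Γ.deleteVertex v).graph ⟨w, hvw.ne'⟩)
  have := ih.2 ⟨_, y, hy.ne⟩ ⟨⟨w, hvw.ne'⟩, by lia⟩
  have hv : degreeWeight (valency Γ.graph v) = -1 := by rw [h2]; rfl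
  lia

end Deletion

theorem excessBound_of_connected (hΓ : Γ.graph.Connected) : Γ.ExcessBound := by
  classical
  induction hn : Fintype.card V using Nat.strong_induction_on generalizing V with | _ n ih =>
  subst hn
  have hlt {W : Type _} [Fintype W] [DecidableEq W] (w : W) :
      Fintype.card ({w}ᶜ : Set W) < Fintype.card W :=
    Fintype.card_subtype_lt (x := w) (by simp)
  have ih₁ (v : V) (hv : (Γ.deleteVertex v).graph.Connected) : (Γ.deleteVertex v).ExcessBound :=
    ih _ (hlt v) hv rfl
  have ih₂ (v : V) (w : ({v}ᶜ : Set V))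
      (hw : ((Γ.deleteVertex v).deleteVertex w).graph.Connected) :
      ((Γ.deleteVertex v).deleteVertex w).ExcessBound :=
    ih _ ((hlt w).trans (hlt v)) hw rfl
  obtain hs | hV := subsingleton_or_nontrivial V
  · exact excessBound_of_subsingleton hΓ
  have hadj (v : V) : ∃ w, Γ.graph.Adj v w := hΓ.preconnected.exists_adj_of_nontrivial v
  by_cases h2 : ∀ v, valency Γ.graph v = 2
  · refine ⟨?_, fun _ ⟨v, hv⟩ => (hv (h2 v)).elim⟩
    have hconn := connected_induce_compl_of_forall_valency_eq_two hΓ h2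
    exact excess_nonneg_of_forall_valency_eq_two hΓ h2 _ (ih₁ (Classical.arbitrary V) (hconn _))
  suffices h : 0 < Γ.excess from ⟨h.le, fun _ _ => h⟩
  by_contra hexc
  have hnoncut (v : V) (hv : (Γ.deleteVertex v).graph.Connected) :
      valency Γ.graph v < 3 ∧ ∀ x, Γ.graph.Adj v x → valency Γ.graph x = 2 := by
    by_contra! h
    obtain ⟨w, hw⟩ := hadj v
    exact hexc (excess_pos_of_connected_deleteVertex hΓ hw hv (by grind) (ih₁ v hv)
      fun w hw => (ih₂ v w hw).1)
  refine h2 fun v => (connected_induce_compl_and_valency_eq_two hΓ (fun v hv => ?_) v).2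
  have ⟨hlt3, hnbr⟩ := hnoncut v hv
  refine ⟨?_, hnbr⟩
  by_contra hv2
  obtain ⟨w, hw⟩ := hadj v
  have hpos := valency_pos_iff.2 ⟨w, hw⟩
  exact hexc (excess_pos_of_valency_eq_one hΓ hw (by lia) (hnbr w hw) (ih₂ v _))

end ExcessBound

section Bipartite

open Matrix QuadraticMap

variable {V : Type*} [Fintype V] (Γ : SignedGraph V)

theorem mem_radical_adjForm_iff {x : V → ℝ} : x ∈ Γ.adjForm.radical ↔ Γ.adjMatrix *ᵥ x = 0 := by
  have : Invertible (2 : ℝ) := invertibleOfNonzero two_ne_zero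
  rw [QuadraticMap.radical_eq_ker_polarBilin, LinearMap.mem_ker, LinearMap.ext_iff,
    ← dotProduct_eq_zero_iff]
  refine forall_congr' fun y => ?_
  rw [polarBilin_apply_apply, polar_comm, polar_adjForm, LinearMap.zero_apply, dotProduct_comm]
  simp

variable {Γ}

theorem adjForm_equivalent_neg (c : Γ.graph.Coloring Bool) : Γ.adjForm.Equivalent (-Γ.adjForm) := by
  let e : (V → ℝ) ≃ₗ[ℝ] (V → ℝ) :=
    LinearEquiv.piCongrRight fun v => bif c v then .refl ℝ ℝ else .neg ℝ
  refine ⟨{ e with map_app' := fun x => ?_ }⟩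
  change (-Γ.adjForm) (e x) = Γ.adjForm x
  simp only [_root_.neg_apply, adjForm_apply, dotProduct, mulVec, Finset.mul_sum,
    ← Finset.sum_neg_distrib]
  refine Fintype.sum_congr _ _ fun u => Fintype.sum_congr _ _ fun v => ?_
  by_cases h : Γ.graph.Adj u v
  · have := c.valid h
    cases hu : c u <;> cases hv : c v <;> simp_all [e]
  · simp [adjMatrix_of_not_adj _ h]

theorem two_mul_posInertia_add_finrank_radical (c : Γ.graph.Coloring Bool) :
    2 * Γ.posInertia + Module.finrank ℝ Γ.adjForm.radical = Fintype.card V := by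
  have h := QuadraticForm.sigPos_add_sigNeg_add_radical (Q := Γ.adjForm)
  rw [(adjForm_equivalent_neg c).sigNeg_eq, sigNeg_neg, ← posInertia_eq_sigPos,
    Module.finrank_fintype_fun_eq_card] at h
  lia

theorem two_mul_posInertia_lt_card_iff (c : Γ.graph.Coloring Bool) :
    2 * Γ.posInertia < Fintype.card V ↔ ∃ x ≠ 0, Γ.adjMatrix *ᵥ x = 0 := by
  have hrank : 0 < Module.finrank ℝ Γ.adjForm.radical ↔ ∃ x ≠ 0, Γ.adjMatrix *ᵥ x = 0 := by
    simp_rw [Module.finrank_pos_iff, Submodule.nontrivial_iff_ne_bot, Submodule.ne_bot_iff,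
      mem_radical_adjForm_iff, and_comm]
  rw [← hrank, ← two_mul_posInertia_add_finrank_radical c]
  lia

end Bipartite

section DisjointUnion

open Matrix QuadraticMap

variable {ι : Type*} {V W : ι → Type*} (C : ∀ i, SignedGraph (V i))

theorem adjMatrix_disjointUnion_same (i : ι) (a b : V i) :
    (disjointUnion C).adjMatrix ⟨i, a⟩ ⟨i, b⟩ = (C i).adjMatrix a b := by
  by_cases h : (C i).graph.Adj a b
  · rw [adjMatrix_of_adj _ h, adjMatrix_of_adj _ ((disjointUnion_adj C).2 h),
      disjointUnion_sign C h]
  · rw [adjMatrix_of_not_adj _ h, adjMatrix_of_not_adj _ fun h' => h ((disjointUnion_adj C).1 h')]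

theorem fst_eq_of_disjointUnion_adj {x y : Σ i, V i} (h : (disjointUnion C).graph.Adj x y) :
    x.1 = y.1 := by
  obtain ⟨i, a, b, -, rfl, rfl⟩ := h
  rfl

theorem adjMatrix_disjointUnion_of_ne {x y : Σ i, V i} (h : x.1 ≠ y.1) :
    (disjointUnion C).adjMatrix x y = 0 :=
  adjMatrix_of_not_adj _ fun h' => h (fst_eq_of_disjointUnion_adj C h')

variable {C}

theorem disjointUnion_isomorphic {D : ∀ i, SignedGraph (W i)} (h : ∀ i, (C i).Isomorphic (D i)) :
    (disjointUnion C).Isomorphic (disjointUnion D) := by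
  simp only [isomorphic_iff] at *
  choose e he using h
  refine ⟨Equiv.sigmaCongrRight e, ?_⟩
  rintro ⟨i, a⟩ ⟨j, b⟩
  obtain rfl | hij := eq_or_ne i j
  · simp only [Equiv.sigmaCongrRight_apply, adjMatrix_disjointUnion_same, he]
  · rw [adjMatrix_disjointUnion_of_ne _ hij, adjMatrix_disjointUnion_of_ne]
    exact hij

theorem isomorphic_disjointUnion_fiber {V : Type*} (Γ : SignedGraph V) (f : V → ι)
    (hf : ∀ u v, Γ.graph.Adj u v → f u = f v) :
    Γ.Isomorphic (disjointUnion fun i => Γ.comap (Subtype.val : {x // f x = i} → V)) := by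
  refine (Γ.isomorphic_comap_equiv (Equiv.sigmaFiberEquiv f)).trans
    (isomorphic_iff.2 ⟨Equiv.refl _, ?_⟩)
  rintro ⟨i, a, ha⟩ ⟨j, b, hb⟩
  obtain rfl | hij := eq_or_ne i j
  · exact adjMatrix_disjointUnion_same ..
  · refine (adjMatrix_disjointUnion_of_ne _ hij).trans (adjMatrix_of_not_adj _ fun h => hij ?_).symm
    exact ha.symm.trans ((hf a b h).trans hb)

theorem disjointUnion_reachable_iff (h : ∀ i, (C i).graph.Preconnected) {x y : Σ i, V i} :
    (disjointUnion C).graph.Reachable x y ↔ x.1 = y.1 := by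
  constructor
  · rintro ⟨p⟩
    induction p with
    | nil => rfl
    | cons hadj _ ih => exact (fst_eq_of_disjointUnion_adj C hadj).trans ih
  · obtain ⟨i, a⟩ := x
    obtain ⟨j, b⟩ := y
    rintro rfl
    exact (h i a b).map
      (⟨Sigma.mk i, (disjointUnion_adj C).2⟩ : (C i).graph →g (disjointUnion C).graph)

theorem card_connectedComponent_disjointUnion (h : ∀ i, (C i).graph.Connected) :
    Nat.card (disjointUnion C).graph.ConnectedComponent = Nat.card ι := by
  have := fun i => (h i).nonempty
  let f (i : ι) := (disjointUnion C).graph.connectedComponentMk ⟨i, Classical.arbitrary (V i)⟩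
  refine (Nat.card_eq_of_bijective f ⟨fun i j hij => ?_, fun c => ?_⟩).symm
  · exact (disjointUnion_reachable_iff fun i => (h i).preconnected).1
      (SimpleGraph.ConnectedComponent.exact hij)
  · induction c using SimpleGraph.ConnectedComponent.ind with | _ x =>
    exact ⟨x.1, SimpleGraph.ConnectedComponent.sound
      ((disjointUnion_reachable_iff fun i => (h i).preconnected).2 rfl)⟩

theorem valency_disjointUnion (i : ι) (a : V i) :
    valency (disjointUnion C).graph ⟨i, a⟩ = valency (C i).graph a := by
  rw [valency, valency, ← Set.ncard_image_of_injective _ (sigma_mk_injective (i := i))]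
  congr 1
  ext ⟨j, b⟩
  constructor
  · intro hadj
    obtain rfl : i = j := fst_eq_of_disjointUnion_adj C hadj
    exact ⟨b, (disjointUnion_adj C).1 hadj, rfl⟩
  · rintro ⟨b, hb, ⟨⟩⟩
    exact (disjointUnion_adj C).2 hb

variable [Fintype ι] [∀ i, Fintype (V i)]

theorem adjMatrix_disjointUnion_mulVec (x : (Σ i, V i) → ℝ) (i : ι) (a : V i) :
    ((disjointUnion C).adjMatrix *ᵥ x) ⟨i, a⟩ =
      ((C i).adjMatrix *ᵥ fun b => x ⟨i, b⟩) a := by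
  rw [mulVec, dotProduct, Fintype.sum_sigma, Fintype.sum_eq_single i fun j hj =>
    Finset.sum_eq_zero fun b _ => by rw [adjMatrix_disjointUnion_of_ne C hj.symm, zero_mul]]
  simp only [adjMatrix_disjointUnion_same, mulVec, dotProduct]

theorem posInertia_disjointUnion : (disjointUnion C).posInertia = ∑ i, (C i).posInertia := by
  have e : (disjointUnion C).adjForm.Equivalent (QuadraticMap.pi fun i => (C i).adjForm) :=
    ⟨{ LinearEquiv.piCurry ℝ fun i (_ : V i) => ℝ with
      map_app' := fun x => by
        simp only [adjForm_apply, QuadraticMap.pi_apply, dotProduct, Fintype.sum_sigma,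
          adjMatrix_disjointUnion_mulVec]
        rfl }⟩
  simp_rw [posInertia_eq_sigPos, e.sigPos_eq, sigPos_pi]

theorem excess_disjointUnion (h : ∀ i, (C i).graph.Connected) :
    (disjointUnion C).excess = ∑ i, (C i).excess := by
  have hweight : totalWeight (disjointUnion C).graph = ∑ i, totalWeight (C i).graph := by
    simp only [totalWeight, Fintype.sum_sigma, valency_disjointUnion]
  rw [excess, posInertia_disjointUnion, card_connectedComponent_disjointUnion h, hweight]
  simp only [fun i => excess_eq_of_connected (h i), Finset.sum_add_distrib, ← Finset.mul_sum]
  simp [mul_comm]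

end DisjointUnion
end SignedGraph

section TwoRegular

variable {V W : Type*} [Finite V] {G : SimpleGraph V}

theorem nonempty_iso_of_copy [Nonempty W] {H : SimpleGraph W} (hG : G.Preconnected)
    (f : H.Copy G) (hf : ∀ i, valency G (f i) ≤ valency H i) : Nonempty (H ≃g G) := by
  have himg (i : W) : f '' H.neighborSet i = G.neighborSet (f i) := by
    refine Set.eq_of_subset_of_ncard_le ?_ ?_
    · rintro _ ⟨j, hj, rfl⟩
      exact f.toHom.map_adj hj
    · rw [Set.ncard_image_of_injective (f := f) _ f.injective]
      exact hf i
  have hsurj : Set.range f = Set.univ := by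
    refine eq_univ_of_preconnected hG (Set.range_nonempty f) ?_
    rintro _ b ⟨i, rfl⟩ hb
    obtain ⟨j, -, hj⟩ := (himg i).symm.subset hb
    exact ⟨j, hj⟩
  refine ⟨⟨Equiv.ofBijective f ⟨f.injective, Set.range_eq_univ.1 hsurj⟩, fun {i j} => ?_⟩⟩
  refine ⟨fun h => ?_, fun h => f.toHom.map_adj h⟩
  obtain ⟨k, hk, hkj⟩ := (himg i).symm.subset h
  exact f.injective hkj ▸ hk

theorem valency_cycleGraph {m : ℕ} (i : Fin (m + 3)) :
    valency (SimpleGraph.cycleGraph (m + 3)) i = 2 := by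
  rw [valency_eq_degree, SimpleGraph.cycleGraph_degree_three_le]

theorem exists_cycleGraph_iso (hG : G.Connected) (h2 : ∀ v, valency G v = 2) :
    ∃ m, Nonempty (SimpleGraph.cycleGraph (m + 3) ≃g G) := by
  obtain ⟨v⟩ := hG.nonempty
  obtain ⟨w, hw, -⟩ := SimpleGraph.IsCycles.exists_cycle_toSubgraph_verts_eq_connectedComponentSupp
    (fun v _ => h2 v) (c := G.connectedComponentMk v) rfl (valency_pos_iff.1 (h2 v ▸ two_pos))
  obtain ⟨m, hm⟩ := Nat.exists_eq_add_of_le' hw.three_le_length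
  obtain ⟨f⟩ := (SimpleGraph.cycleGraph_isContained_iff hw.three_le_length).2 ⟨v, w, hw, rfl⟩
  rw [hm] at f
  exact ⟨m, nonempty_iso_of_copy hG.preconnected f fun i => by rw [h2, valency_cycleGraph]⟩

theorem mem_edges_of_isCycle (hG : G.Preconnected) (h2 : ∀ v, valency G v = 2) {u : V}
    {w : G.Walk u u} (hw : w.IsCycle) {e : Sym2 V} (he : e ∈ G.edgeSet) : e ∈ w.edges := by
  have hadj {x y : V} (hx : x ∈ w.support) (h : G.Adj x y) : w.toSubgraph.Adj x y := by
    have hN : w.toSubgraph.neighborSet x = G.neighborSet x :=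
      Set.eq_of_subset_of_ncard_le (w.toSubgraph.neighborSet_subset x)
        ((h2 x).trans (hw.ncard_neighborSet_toSubgraph_eq_two hx).symm).le
    exact hN.symm.subset h
  have hall : {x | x ∈ w.support} = Set.univ :=
    eq_univ_of_preconnected hG ⟨u, w.start_mem_support⟩ fun x y hx h =>
      w.mem_verts_toSubgraph.1 (hadj hx h).snd_mem
  induction e using Sym2.ind with | _ x y =>
  rw [← SimpleGraph.Walk.mem_edges_toSubgraph, SimpleGraph.Subgraph.mem_edgeSet]
  exact hadj (hall.symm.subset (Set.mem_univ x)) he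

end TwoRegular

section Recurrence

open Function Finset

variable {R : Type*} [CommRing R] {σ : ℕ → R}

theorem prod_range_mul_self (hσ : ∀ k, σ k * σ k = 1) (k : ℕ) :
    (∏ i ∈ range k, σ i) * ∏ i ∈ range k, σ i = 1 := by
  rw [← prod_mul_distrib]
  exact prod_eq_one fun i _ => hσ i

theorem antiperiodic_prod_range_mul_iff (hσ : ∀ k, σ k * σ k = 1) (y : ℕ → R) :
    Antiperiodic (fun k => (∏ i ∈ range k, σ i) * y k) 2 ↔
      ∀ k, σ k * y k + σ (k + 1) * y (k + 2) = 0 := by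
  refine forall_congr' fun k => ?_
  simp only [prod_range_succ]
  constructor <;> intro h
  · linear_combination (∏ i ∈ range k, σ i) * σ k * h -
      (σ k * y k + σ k ^ 2 * σ (k + 1) * y (k + 2)) * prod_range_mul_self hσ k -
      σ (k + 1) * y (k + 2) * hσ k
  · linear_combination (∏ i ∈ range k, σ i) * σ k * h - (∏ i ∈ range k, σ i) * y k * hσ k

theorem exists_periodic_solution_iff {σ : ℕ → ℝ} {l : ℕ} (hper : Periodic σ (2 * l))
    (hσ : ∀ k, σ k * σ k = 1) :
    (∃ y ≠ 0, Periodic y (2 * l) ∧ ∀ k, σ k * y k + σ (k + 1) * y (k + 2) = 0) ↔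
      ∏ i ∈ range (2 * l), σ i = (-1) ^ l := by
  simp_rw [← antiperiodic_prod_range_mul_iff hσ]
  have hshift (k : ℕ) :
      ∏ i ∈ range (k + 2 * l), σ i = (∏ i ∈ range (2 * l), σ i) * ∏ i ∈ range k, σ i := by
    rw [add_comm, prod_range_add]
    exact congrArg _ (prod_congr rfl fun i _ => by rw [add_comm, hper])
  constructor
  · rintro ⟨y, hy, hyper, hanti⟩
    obtain ⟨k, hk⟩ := Function.ne_iff.1 hy
    have hz : (∏ i ∈ range k, σ i) * y k ≠ 0 :=
      mul_ne_zero (left_ne_zero_of_mul_eq_one (prod_range_mul_self hσ k)) hk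
    have h := hanti.add_nat_mul_eq l (x := k)
    rw [Nat.cast_id, mul_comm l, hshift, hyper, mul_assoc] at h
    exact mul_right_cancel₀ hz h
  · intro h
    refine ⟨fun k => (∏ i ∈ range k, σ i) * Real.cos (k * (Real.pi / 2)), ?_, fun k => ?_,
      fun k => ?_⟩
    · exact Function.ne_iff.2 ⟨0, by simp⟩
    · have harg : ((k + 2 * l : ℕ) : ℝ) * (Real.pi / 2) = k * (Real.pi / 2) + l * Real.pi := by
        push_cast
        ring
      beta_reduce
      rw [hshift, h, harg, Real.cos_add_nat_mul_pi, mul_mul_mul_comm, ← mul_pow, neg_one_mul,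
        neg_neg, one_pow, one_mul]
    · have harg : ((k + 2 : ℕ) : ℝ) * (Real.pi / 2) = k * (Real.pi / 2) + Real.pi := by
        push_cast
        ring
      simp only [← mul_assoc, prod_range_mul_self hσ, one_mul, harg, Real.cos_add_pi]

end Recurrence

namespace SignedGraph

section WalkSign

variable {V : Type*} (Γ : SignedGraph V)

/-- The entry of the adjacency matrix at an unordered pair of vertices. Unlike `SignedGraph.sign`
it needs no proof that the pair is an edge. -/
noncomputable def weight : Sym2 V → ℝ :=
  Sym2.lift ⟨Γ.adjMatrix, fun u v => Γ.adjMatrix_isSymm.apply v u⟩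

theorem weight_of_mem (e : Γ.graph.edgeSet) : Γ.weight e = ((Γ.sign e : ℤ) : ℝ) := by
  obtain ⟨e, he⟩ := e
  induction e using Sym2.ind with | _ u v =>
  exact Γ.adjMatrix_of_adj he

theorem walkSign_eq_prod_weight {u v : V} (w : Γ.graph.Walk u v) :
    ((Γ.walkSign w : ℤ) : ℝ) = (w.edges.map Γ.weight).prod := by
  have h := map_list_prod ((Int.castRingHom ℝ : ℤ →* ℝ).comp (Units.coeHom ℤ))
    (w.edges.attach.map fun e => Γ.sign ⟨e.1, w.edges_subset_edgeSet e.2⟩)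
  refine h.trans ?_
  conv_rhs => rw [← List.attach_map_subtype_val w.edges]
  rw [List.map_map, List.map_map]
  refine congrArg List.prod (List.map_congr_left fun e _ => ?_)
  exact (Γ.weight_of_mem ⟨e.1, w.edges_subset_edgeSet e.2⟩).symm

end WalkSign

section Cycle

open Function Matrix SimpleGraph

variable {m : ℕ} {C : SignedGraph (Fin (m + 3))}

theorem cycle_adj_add_one (hC : C.graph = cycleGraph (m + 3)) (i : Fin (m + 3)) :
    C.graph.Adj i (i + 1) := by
  rw [hC]
  exact Or.inr (by simp)

theorem cycle_valency (hC : C.graph = cycleGraph (m + 3)) (i : Fin (m + 3)) :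
    valency C.graph i = 2 := hC ▸ valency_cycleGraph i

theorem cycle_connected (hC : C.graph = cycleGraph (m + 3)) : C.graph.Connected :=
  hC ▸ cycleGraph_connected

theorem self_ne_add_one_add_one (i : Fin (m + 3)) : i ≠ i + 1 + 1 := by
  rw [add_assoc, ne_eq, left_eq_add]
  exact ne_of_beq_false rfl

theorem cycle_excess (hC : C.graph = cycleGraph (m + 3)) :
    C.excess = 2 * C.posInertia + 2 - (m + 3) := by
  have hweight : totalWeight C.graph = -(m + 3) := by
    simp [totalWeight, cycle_valency hC, degreeWeight]
  rw [excess_eq_of_connected (cycle_connected hC), hweight]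
  ring

/-- The product of the signs around a cycle. -/
noncomputable def cycleSign (C : SignedGraph (Fin (m + 3))) : ℝ :=
  ∏ i, C.adjMatrix i (i + 1)

theorem cycleSign_mul_self (hC : C.graph = cycleGraph (m + 3)) :
    C.cycleSign * C.cycleSign = 1 := by
  rw [cycleSign, ← Finset.prod_mul_distrib]
  exact Finset.prod_eq_one fun i _ => C.adjMatrix_mul_self_of_adj (cycle_adj_add_one hC i)

theorem edgeSet_cycleGraph :
    (cycleGraph (m + 3)).edgeSet = Set.range fun i : Fin (m + 3) => s(i, i + 1) := by
  ext e
  induction e using Sym2.ind with | _ a b =>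
  rw [mem_edgeSet, cycleGraph_adj, sub_eq_iff_eq_add', sub_eq_iff_eq_add']
  constructor
  · rintro (rfl | rfl)
    · exact ⟨b, Sym2.eq_swap⟩
    · exact ⟨a, rfl⟩
  · rintro ⟨i, hi⟩
    obtain ⟨rfl, rfl⟩ | ⟨rfl, rfl⟩ := Sym2.eq_iff.1 hi <;> simp

theorem cycle_walkSign (hC : C.graph = cycleGraph (m + 3)) {u : Fin (m + 3)}
    {w : C.graph.Walk u u} (hw : w.IsCycle) : ((C.walkSign w : ℤ) : ℝ) = C.cycleSign := by
  have hinj : Injective fun i : Fin (m + 3) => s(i, i + 1) := by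
    intro i j hij
    obtain ⟨h, -⟩ | ⟨h, h'⟩ := Sym2.eq_iff.1 hij
    · exact h
    · exact (self_ne_add_one_add_one j (h ▸ h').symm).elim
  have hedges : w.edges.toFinset = Finset.univ.image fun i : Fin (m + 3) => s(i, i + 1) := by
    ext e
    have he : e ∈ w.edges ↔ e ∈ C.graph.edgeSet := ⟨fun he => w.edges_subset_edgeSet he,
      mem_edges_of_isCycle (cycle_connected hC).preconnected (cycle_valency hC) hw⟩
    simp [he, hC, edgeSet_cycleGraph]
  rw [walkSign_eq_prod_weight, ← List.prod_toFinset _ hw.isCircuit.isTrail.edges_nodup, hedges,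
    Finset.prod_image hinj.injOn]
  rfl

theorem cycle_balanced_iff (hC : C.graph = cycleGraph (m + 3)) :
    C.Balanced ↔ C.cycleSign = 1 := by
  have hcast (s : ℤˣ) : ((s : ℤ) : ℝ) = 1 ↔ s = 1 := by
    rw [Int.cast_eq_one, Units.val_eq_one]
  constructor
  · intro h
    have hw : ((cycleGraph.cycle m).mapLe hC.ge).IsCycle := cycleGraph.isCycle_cycle.mapLe hC.ge
    rw [← cycle_walkSign hC hw, hcast]
    exact h _ _ hw
  · intro h v w hw
    rw [← hcast, cycle_walkSign hC hw, h]

theorem cycle_mulVec (hC : C.graph = cycleGraph (m + 3)) (x : Fin (m + 3) → ℝ)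
    (i : Fin (m + 3)) : (C.adjMatrix *ᵥ x) (i + 1) =
      C.adjMatrix i (i + 1) * x i + C.adjMatrix (i + 1) (i + 1 + 1) * x (i + 1 + 1) := by
  rw [C.adjMatrix_isSymm.apply (i + 1) i]
  simp only [mulVec, dotProduct]
  refine Finset.sum_eq_add i (i + 1 + 1) (self_ne_add_one_add_one i) (fun j _ hj => ?_)
    (by simp) (by simp)
  rw [C.adjMatrix_of_not_adj, zero_mul]
  rw [hC, ← mem_neighborSet, cycleGraph_neighborSet]
  simpa using hj

open scoped Fin.CommRing

/-- The sign of the `k`-th edge of a cycle, where `k` is read modulo the length of the cycle. -/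
noncomputable def stepSign (C : SignedGraph (Fin (m + 3))) (k : ℕ) : ℝ :=
  C.adjMatrix (k : Fin (m + 3)) ((k : Fin (m + 3)) + 1)

theorem periodic_stepSign (C : SignedGraph (Fin (m + 3))) : Periodic C.stepSign (m + 3) :=
  fun k => by simp [stepSign]

theorem prod_stepSign (C : SignedGraph (Fin (m + 3))) :
    ∏ k ∈ Finset.range (m + 3), C.stepSign k = C.cycleSign := by
  rw [← Fin.prod_univ_eq_prod_range]
  simp only [stepSign, Fin.cast_val_eq_self, cycleSign]

theorem cycle_exists_mulVec_eq_zero_iff (hC : C.graph = cycleGraph (m + 3)) :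
    (∃ x ≠ 0, C.adjMatrix *ᵥ x = 0) ↔ ∃ y ≠ 0, Periodic y (m + 3) ∧
      ∀ k, C.stepSign k * y k + C.stepSign (k + 1) * y (k + 2) = 0 := by
  have hmul (x : Fin (m + 3) → ℝ) (k : ℕ) : (C.adjMatrix *ᵥ x) ((k + 1 : ℕ) : Fin (m + 3)) =
      C.stepSign k * x (k : ℕ) + C.stepSign (k + 1) * x ((k + 2 : ℕ) : Fin (m + 3)) := by
    have h2 : ((k + 2 : ℕ) : Fin (m + 3)) = (k : Fin (m + 3)) + 1 + 1 := by
      push_cast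
      rw [add_assoc, one_add_one_eq_two]
    rw [h2, Nat.cast_succ, cycle_mulVec hC, stepSign, stepSign, Nat.cast_succ]
  constructor
  · rintro ⟨x, hx, hAx⟩
    obtain ⟨i, hi⟩ := Function.ne_iff.1 hx
    refine ⟨fun k => x k, Function.ne_iff.2 ⟨i, by simpa using hi⟩, fun k => by simp, fun k => ?_⟩
    rw [← hmul, hAx, Pi.zero_apply]
  · rintro ⟨y, hy, hper, hrec⟩
    have hval (k : ℕ) : y (k : Fin (m + 3)) = y k := by
      rw [Fin.val_natCast]
      exact hper.map_mod_nat k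
    obtain ⟨k, hk⟩ := Function.ne_iff.1 hy
    refine ⟨fun i => y i, Function.ne_iff.2 ⟨k, (hval k).trans_ne hk⟩, ?_⟩
    funext i
    obtain ⟨k, rfl⟩ : ∃ k : ℕ, i = (k + 1 : ℕ) := ⟨(i - 1 : Fin (m + 3)), by simp⟩
    rw [hmul, hval, hval, hrec, Pi.zero_apply]

theorem cycle_excess_eq_zero_iff_cycleSign (hC : C.graph = cycleGraph (m + 3)) {l : ℕ}
    (hl : m + 3 = 2 * l) : C.excess = 0 ↔ C.cycleSign = (-1) ^ l := by
  let c : C.graph.Coloring Bool :=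
    (cycleGraph.bicoloring_of_even (m + 3) ⟨l, by lia⟩).comp (Hom.ofLE hC.le)
  have hsign (k : ℕ) : C.stepSign k * C.stepSign k = 1 :=
    C.adjMatrix_mul_self_of_adj (cycle_adj_add_one hC k)
  have hper : Periodic C.stepSign (2 * l) := hl ▸ C.periodic_stepSign
  have hsolution := exists_periodic_solution_iff hper hsign
  rw [← hl, prod_stepSign] at hsolution
  have hlt := two_mul_posInertia_lt_card_iff c
  rw [cycle_exists_mulVec_eq_zero_iff hC, Fintype.card_fin, hsolution] at hlt
  have hnonneg := (excessBound_of_connected (cycle_connected hC)).1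
  rw [cycle_excess hC] at hnonneg ⊢
  rw [← hlt]
  lia

theorem cycle_excess_eq_zero_iff (hC : C.graph = cycleGraph (m + 3)) : C.excess = 0 ↔
    (C.Balanced → m + 3 ≡ 0 [MOD 4]) ∧ (¬ C.Balanced → m + 3 ≡ 2 [MOD 4]) := by
  unfold Nat.ModEq
  obtain ⟨l, hl | hl⟩ := Nat.even_or_odd' (m + 3)
  · rw [cycle_excess_eq_zero_iff_cycleSign hC hl, cycle_balanced_iff hC]
    obtain h | h := mul_self_eq_one_iff.1 (cycleSign_mul_self hC)
    · rw [h, eq_comm, neg_one_pow_eq_one_iff_even (by norm_num), Nat.even_iff]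
      lia
    · rw [h, eq_comm, neg_one_pow_eq_neg_one_iff_odd (by norm_num), Nat.odd_iff]
      have : (-1 : ℝ) ≠ 1 := by norm_num
      lia
  · rw [cycle_excess hC]
    by_cases hb : C.Balanced <;> simp only [hb, true_imp_iff, not_true, not_false_iff] <;> lia

end Cycle

open SimpleGraph

section Pieces

variable {ι : Type*} [Fintype ι]

theorem excess_disjointUnion_eq_zero_iff {V : ι → Type*} [∀ i, Fintype (V i)]
    {C : ∀ i, SignedGraph (V i)} (h : ∀ i, (C i).graph.Connected) :
    (disjointUnion C).excess = 0 ↔ ∀ i, (C i).excess = 0 := by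
  rw [excess_disjointUnion h,
    Finset.sum_eq_zero_iff_of_nonneg fun i _ => (excessBound_of_connected (h i)).1]
  simp

theorem excess_disjointUnion_cycles_eq_zero_iff {n : ι → ℕ} {C : ∀ i, SignedGraph (Fin (n i))}
    (hC : ∀ i, 3 ≤ n i ∧ (C i).graph = cycleGraph (n i)) : (disjointUnion C).excess = 0 ↔
      ∀ i, ((C i).Balanced → n i ≡ 0 [MOD 4]) ∧ (¬ (C i).Balanced → n i ≡ 2 [MOD 4]) := by
  choose m hm using fun i => Nat.exists_eq_add_of_le' (hC i).1
  obtain rfl : n = fun i => m i + 3 := funext hm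
  rw [excess_disjointUnion_eq_zero_iff fun i => cycle_connected (hC i).2]
  exact forall_congr' fun i => cycle_excess_eq_zero_iff (hC i).2

end Pieces

variable {V : Type*}

theorem exists_isomorphic_cycle [Fintype V] {Γ : SignedGraph V} [Nontrivial V]
    (hΓ : Γ.graph.Connected) (h0 : Γ.excess = 0) :
    ∃ n, ∃ C : SignedGraph (Fin n), (3 ≤ n ∧ C.graph = cycleGraph n) ∧ Γ.Isomorphic C := by
  have hval : ∀ v, valency Γ.graph v = 2 := by
    by_contra! h
    exact h0.not_gt ((excessBound_of_connected hΓ).2 ‹_› h)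
  obtain ⟨m, ⟨φ⟩⟩ := exists_cycleGraph_iso hΓ hval
  refine ⟨m + 3, Γ.comap φ.toEquiv, ⟨by lia, ?_⟩, Γ.isomorphic_comap_equiv φ.toEquiv⟩
  ext a b
  exact φ.map_adj_iff

theorem exists_isomorphic_disjointUnion_connected [Finite V] (Γ : SignedGraph V)
    (hΓ : ∀ c : Γ.graph.ConnectedComponent, 2 ≤ c.supp.ncard) :
    ∃ (t : ℕ) (s : Fin t → Set V) (C : ∀ i, SignedGraph (s i)),
      (∀ i, (s i).Nontrivial ∧ (C i).graph.Connected) ∧ Γ.Isomorphic (disjointUnion C) := by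
  obtain ⟨t, ⟨e⟩⟩ := Finite.exists_equiv_fin Γ.graph.ConnectedComponent
  let f : V → Fin t := fun v => e (Γ.graph.connectedComponentMk v)
  have hsupp (i : Fin t) : {x | f x = i} = (e.symm i).supp := by
    ext x
    simp [f, ← Equiv.eq_symm_apply]
  have hnontrivial (i : Fin t) : {x | f x = i}.Nontrivial := by
    rw [hsupp, ← Set.one_lt_ncard_iff_nontrivial]
    exact hΓ _
  have hconn (i : Fin t) : (Γ.graph.induce {x | f x = i}).Connected := by
    rw [hsupp]
    exact (e.symm i).connected_toSimpleGraph
  exact ⟨t, fun i => {x | f x = i}, _, fun i => ⟨hnontrivial i, hconn i⟩,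
    Γ.isomorphic_disjointUnion_fiber f fun u v h =>
      congrArg e (ConnectedComponent.sound h.reachable)⟩

theorem exists_isomorphic_disjointUnion_cycles [Fintype V] (Γ : SignedGraph V)
    (hΓ : ∀ c : Γ.graph.ConnectedComponent, 2 ≤ c.supp.ncard) (h0 : Γ.excess = 0) :
    ∃ (t : ℕ) (n : Fin t → ℕ) (C : ∀ i, SignedGraph (Fin (n i))),
      (∀ i, 3 ≤ n i ∧ (C i).graph = cycleGraph (n i)) ∧ Γ.Isomorphic (disjointUnion C) := by
  classical
  obtain ⟨t, s, D, hD, hΓD⟩ := Γ.exists_isomorphic_disjointUnion_connected hΓ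
  rw [hΓD.excess_eq, excess_disjointUnion_eq_zero_iff fun i => (hD i).2] at h0
  have hcycle (i : Fin t) := have := (hD i).1.coe_sort; exists_isomorphic_cycle (hD i).2 (h0 i)
  choose n C hC hDC using hcycle
  exact ⟨t, n, C, hC, hΓD.trans (disjointUnion_isomorphic hDC)⟩

theorem Isomorphic.card_eq_sum [Fintype V] {ι : Type*} [Fintype ι] {n : ι → ℕ}
    {C : ∀ i, SignedGraph (Fin (n i))} {Γ : SignedGraph V} (h : Γ.Isomorphic (disjointUnion C)) :
    Fintype.card V = ∑ i, n i := by
  obtain ⟨φ, -⟩ := h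
  simp [Fintype.card_congr φ.toEquiv]

end SignedGraph

theorem theorem3p2 {V : Type*} [Fintype V] (Γ : SignedGraph V)
    (hΓ : ∀ c : Γ.graph.ConnectedComponent, 2 ≤ c.supp.ncard) :
    (Γ.posInertia : ℝ) =
        ((Fintype.card V : ℝ) - (Γ.pendantCount : ℝ)) / 2 - (Γ.cyclomaticNumber : ℝ) ↔
      ∃ (t : ℕ) (n : Fin t → ℕ) (C : ∀ i, SignedGraph (Fin (n i))),
        (∀ i, 3 ≤ n i ∧ (C i).graph = SimpleGraph.cycleGraph (n i)) ∧
        ∑ i, n i = Fintype.card V ∧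
        (∀ i, ((C i).Balanced → n i ≡ 0 [MOD 4]) ∧ (¬ (C i).Balanced → n i ≡ 2 [MOD 4])) ∧
        Γ.Isomorphic (SignedGraph.disjointUnion C) := by
  rw [Γ.posInertia_eq_iff_excess_eq_zero hΓ]
  constructor
  · intro h0
    obtain ⟨t, n, C, hC, hiso⟩ := Γ.exists_isomorphic_disjointUnion_cycles hΓ h0
    rw [hiso.excess_eq, SignedGraph.excess_disjointUnion_cycles_eq_zero_iff hC] at h0
    exact ⟨t, n, C, hC, hiso.card_eq_sum.symm, h0, hiso⟩
  · rintro ⟨t, n, C, hC, -, hmod, hiso⟩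
    rwa [hiso.excess_eq, SignedGraph.excess_disjointUnion_cycles_eq_zero_iff hC]
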